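/- Let $k\ge 1$. A $k$-tree is a finite simple graph $G$ whose vertices can be ordered $v_1,\dots,v_n$, $n\ge k+1$, such that $v_1,\dots,v_{k+1}$ form a clique and, for every $i\ge k+2$, the neighbours of $v_i$ among $v_1,\dots,v_{i-1}$ are exactly the vertices of a $k$-clique. A crossing-free straight-line drawing of a graph maps its vertices injectively to points of the plane and its edges to the straight-line segments connecting the corresponding points, such that no edge contains a vertex other than its endpoints and two distinct edges intersect at most in common endpoints. A segment of such a drawing is an inclusion-maximal set of edges whose union is a line segment, and the segment number $\operatorname{seg}(G)$ of a planar graph $G$ is the smallest number of segments over all crossing-free straight-line drawings of $G$. Theorem. For every planar 3-tree $G$ with $n\ge 6$ vertices, $\operatorname{seg}(G)\ge n+4$. -/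

import Mathlib

/-- The Euclidean plane. -/
abbrev Plane : Type := EuclideanSpace ℝ (Fin 2)

namespace SimpleGraph

/-- `G` is a `k`-tree: its vertices have an order (a stacking order) whose first `k + 1` vertices
form a clique, and in which every later vertex is adjacent, among the vertices before it, to exactly
the vertices of some `k`-clique. -/
def IsKTree {V : Type*} [Fintype V] (k : ℕ) (G : SimpleGraph V) : Prop :=
  k + 1 ≤ Fintype.card V ∧
    ∃ σ : Fin (Fintype.card V) ≃ V,
      G.IsClique (σ '' {i | i.val < k + 1}) ∧
      ∀ i : Fin (Fintype.card V), k + 1 ≤ i.val →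
        ∃ Q : Finset V, G.IsNClique k Q ∧ G.neighborSet (σ i) ∩ σ '' {j | j < i} = (Q : Set V)

/-- Placing every vertex `v` at the point `p v` and drawing every edge `e` as the point set `A e`
is injective on the vertices and crossing-free: an edge contains no vertex other than its
endpoints, and two distinct edges meet at most in common endpoints. -/
def IsCrossingFree {V : Type*} (G : SimpleGraph V) (p : V → Plane) (A : Sym2 V → Set Plane) :
    Prop :=
  Function.Injective p ∧
    (∀ e ∈ G.edgeSet, ∀ v : V, p v ∈ A e → v ∈ e) ∧
    ∀ e ∈ G.edgeSet, ∀ f ∈ G.edgeSet, e ≠ f → A e ∩ A f ⊆ p '' {v | v ∈ e ∧ v ∈ f}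

/-- `G` is planar: it has a crossing-free drawing in the plane in which every edge is a simple
curve between its endpoints. -/
def IsPlanar {V : Type*} (G : SimpleGraph V) : Prop :=
  ∃ (p : V → Plane) (A : Sym2 V → Set Plane),
    (∀ u v : V, G.Adj u v →
      ∃ γ : _root_.Path (p u) (p v), Function.Injective γ ∧ Set.range γ = A s(u, v)) ∧
    G.IsCrossingFree p A

/-- The closed straight-line segment that represents the pair `e` when `v` is placed at `p v`. -/
def edgeSegment {V : Type*} (p : V → Plane) (e : Sym2 V) : Set Plane :=
  Sym2.lift ⟨fun u v => segment ℝ (p u) (p v), fun u v => segment_symm ℝ (p u) (p v)⟩ e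

/-- The vertex placement `p` gives a crossing-free straight-line drawing of `G`. -/
def IsStraightLineDrawing {V : Type*} (G : SimpleGraph V) (p : V → Plane) : Prop :=
  G.IsCrossingFree p (edgeSegment p)

/-- The edges in `S` together form a line segment in the straight-line drawing `p` of `G`. -/
def FormsSegment {V : Type*} (G : SimpleGraph V) (p : V → Plane) (S : Set (Sym2 V)) : Prop :=
  S ⊆ G.edgeSet ∧ ∃ a b : Plane, a ≠ b ∧ (⋃ e ∈ S, edgeSegment p e) = segment ℝ a b

/-- The segments of the straight-line drawing `p` of `G`: the maximal sets of edges that together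
form a line segment. -/
def drawingSegments {V : Type*} (G : SimpleGraph V) (p : V → Plane) : Set (Set (Sym2 V)) :=
  {S | Maximal (G.FormsSegment p) S}

/-- The segment number of `G`: the smallest number of segments of a crossing-free straight-line
drawing of `G` (it is `⊤` exactly for graphs that have no such drawing or only drawings with
infinitely many segments). -/
noncomputable def segmentNumber {V : Type*} (G : SimpleGraph V) : ℕ∞ :=
  ⨅ (p : V → Plane) (_ : G.IsStraightLineDrawing p), (G.drawingSegments p).encard

end SimpleGraph

/-!
Call a directed edge `(z, v)` a *port* if no edge at `v` continues it straight beyond `v`. A port is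
an end of the segment that contains it, and a segment has only two ends, so there are at most
`2 * seg` ports.

Every straight-line drawing of a 3-tree on `n` vertices has a triangular outer face `T` and
`2 * n - 5` triangular inner faces: a vertex stacked inside `T` subdivides the inner face on which
it is stacked, and a vertex stacked outside `T` turns `T` into an inner face of a drawing of `K₄`.
The corners of `T` are extreme points of the drawing, so every edge directed into a corner is a
port; for `n ≥ 6` there are at least `12` of these. Moreover every inner face is entered by the
straight prolongation of some edge beyond its end. Such an edge is a port, because no edge runs
through the interior of a face; it is not directed into a corner of `T`; and different faces yield
different edges. Hence `2 * seg ≥ (2 * n - 5) + 12 = 2 * n + 7`, that is, `seg ≥ n + 4`.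
-/

open Set Filter Topology

namespace StraightLineDrawing

section AffineBasis

variable {ι E : Type*} [NormedAddCommGroup E] [NormedSpace ℝ E] (b : AffineBasis ι ℝ E)

lemma coord_eq_zero_of_mem_convexHull_image_compl {i : ι} {x : E}
    (hx : x ∈ convexHull ℝ (b '' {i}ᶜ)) : b.coord i x = 0 := by
  have hconv : Convex ℝ (b.coord i ⁻¹' {0}) := (convex_singleton 0).affine_preimage _
  refine convexHull_min ?_ hconv hx
  rintro _ ⟨j, hj, rfl⟩
  exact b.coord_apply_ne (Ne.symm hj)

variable [Finite ι]

lemma mem_convexHull_image_compl_of_coord_eq_zero {i : ι} {x : E}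
    (hx : x ∈ convexHull ℝ (range b)) (hi : b.coord i x = 0) :
    x ∈ convexHull ℝ (b '' {i}ᶜ) := by
  classical
  have := Fintype.ofFinite ι
  rw [b.convexHull_eq_nonneg_coord] at hx
  have hsum : ∑ j ∈ Finset.univ.erase i, b.coord j x = 1 := by
    rw [Finset.sum_erase (f := fun j ↦ b.coord j x) _ hi, b.sum_coord_apply_eq_one]
  have hcomb : ∑ j ∈ Finset.univ.erase i, b.coord j x • b j = x := by
    rw [Finset.sum_erase _ (by rw [hi, zero_smul]), b.linear_combination_coord_eq_self]
  rw [← hcomb]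
  exact (convex_convexHull ℝ _).sum_mem (fun j _ ↦ hx j) hsum fun j hj ↦
    subset_convexHull ℝ _ (mem_image_of_mem b (Finset.ne_of_mem_erase hj))

lemma exists_mem_convexHull_image_compl {x : E} (hx : x ∈ convexHull ℝ (range b))
    (hx' : x ∉ interior (convexHull ℝ (range b))) : ∃ i, x ∈ convexHull ℝ (b '' {i}ᶜ) := by
  have := Fintype.ofFinite ι
  have hnonneg : ∀ i, 0 ≤ b.coord i x := by rwa [b.convexHull_eq_nonneg_coord] at hx
  rw [b.interior_convexHull, mem_ofPred_eq, not_forall] at hx'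
  obtain ⟨i, hi⟩ := hx'
  exact ⟨i, mem_convexHull_image_compl_of_coord_eq_zero b hx
    (le_antisymm (not_lt.1 hi) (hnonneg i))⟩

lemma disjoint_convexHull_image_compl_interior (i : ι) :
    Disjoint (convexHull ℝ (b '' {i}ᶜ)) (interior (convexHull ℝ (range b))) := by
  have := Fintype.ofFinite ι
  rw [b.interior_convexHull, Set.disjoint_left]
  exact fun x hx hpos ↦ (hpos i).ne' (coord_eq_zero_of_mem_convexHull_image_compl b hx)

lemma exists_mem_segment_mem_convexHull_image_compl {x y : E}
    (hx : x ∈ convexHull ℝ (range b)) (hy : y ∉ interior (convexHull ℝ (range b))) :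
    ∃ i, ∃ z ∈ segment ℝ x y, z ∈ convexHull ℝ (b '' {i}ᶜ) := by
  have : FiniteDimensional ℝ E := b.finiteDimensional
  have hclosed : IsClosed (convexHull ℝ (range b)) :=
    (finite_range b).isCompact_convexHull (𝕜 := ℝ) |>.isClosed
  by_contra! hdisj
  have hint : ∀ z ∈ segment ℝ x y, z ∈ convexHull ℝ (range b) →
      z ∈ interior (convexHull ℝ (range b)) := fun z hz hzb ↦ by
    by_contra hz'
    obtain ⟨i, hi⟩ := exists_mem_convexHull_image_compl b hzb hz'
    exact hdisj i z hz hi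
  have hx' := hint x (left_mem_segment ℝ x y) hx
  have hsub := (convex_segment x y).isPreconnected.subset_of_closure_inter_subset isOpen_interior
    ⟨x, left_mem_segment ℝ x y, hx'⟩
    fun z hz ↦ hint z hz.2 (closure_minimal interior_subset hclosed hz.1)
  exact hy (hsub (right_mem_segment ℝ x y))

lemma apply_mem_extremePoints (i : ι) :
    b i ∈ (convexHull ℝ (range b)).extremePoints ℝ := by
  have := Fintype.ofFinite ι
  refine mem_extremePoints_iff_left.2
    ⟨subset_convexHull ℝ _ (mem_range_self i), fun x hx y hy hi ↦ ?_⟩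
  rw [b.convexHull_eq_nonneg_coord] at hx hy
  rw [openSegment_eq_image_lineMap] at hi
  obtain ⟨t, ⟨ht₀, ht₁⟩, ht⟩ := hi
  have hzero : ∀ j ≠ i, b.coord j x = 0 := fun j hj ↦ by
    have hj0 := b.coord_apply_ne hj
    rw [← ht, AffineMap.apply_lineMap, AffineMap.lineMap_apply_ring] at hj0
    exact le_antisymm (by nlinarith [mul_nonneg ht₀.le (hy j)]) (hx j)
  refine b.ext_elem fun j ↦ ?_
  obtain rfl | hj := eq_or_ne j i
  · rw [b.coord_apply_eq, ← b.sum_coord_apply_eq_one x, Fintype.sum_eq_single j hzero]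
  · rw [hzero j hj, b.coord_apply_ne hj]

end AffineBasis

section Subdivision

variable {ι E : Type*} [DecidableEq ι] [NormedAddCommGroup E] [NormedSpace ℝ E]
  (b : AffineBasis ι ℝ E) {w : E}

lemma coord_mul_coord_le_of_mem_convexHull_range_update {i : ι} (hw : 0 ≤ b.coord i w) (j : ι)
    {x : E} (hx : x ∈ convexHull ℝ (range (Function.update b i w))) :
    b.coord j w * b.coord i x ≤ b.coord i w * b.coord j x := by
  let φ : E →ᵃ[ℝ] ℝ := b.coord j w • b.coord i - b.coord i w • b.coord j
  have hconv : Convex ℝ (φ ⁻¹' Iic 0) := (convex_Iic 0).affine_preimage φ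
  have hgen : range (Function.update b i w) ⊆ φ ⁻¹' Iic 0 := by
    rintro _ ⟨k, rfl⟩
    rw [mem_preimage, mem_Iic]
    refine sub_nonpos.2 (?_ : b.coord j w * b.coord i _ ≤ b.coord i w * b.coord j _)
    obtain rfl | hk := eq_or_ne k i
    · rw [Function.update_self, mul_comm]
    · rw [Function.update_of_ne hk, b.coord_apply_ne hk.symm, mul_zero, b.coord_apply]
      positivity
  exact sub_nonpos.1 (convexHull_min hgen hconv hx)

variable [Finite ι]

lemma mem_convexHull_range_update {i : ι} {x : E} (hw : 0 < b.coord i w) (hx : 0 ≤ b.coord i x)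
    (hle : ∀ j, b.coord i x * b.coord j w ≤ b.coord j x * b.coord i w) :
    x ∈ convexHull ℝ (range (Function.update b i w)) := by
  have := Fintype.ofFinite ι
  set t := b.coord i x / b.coord i w with ht
  have hti : b.coord i x - t * b.coord i w = 0 := by
    rw [ht, div_mul_cancel₀ _ hw.ne', sub_self]
  have hcomb (j : ι) : (b.coord j x - t * b.coord j w) • Function.update b i w j =
      b.coord j x • b j - t • b.coord j w • b j := by
    obtain rfl | hj := eq_or_ne j i
    · rw [hti, zero_smul, ← mul_smul, ← sub_smul, hti, zero_smul]
    · rw [Function.update_of_ne hj, sub_smul, mul_smul]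
  refine mem_convexHull_of_exists_fintype
    (fun o : Option ι ↦ o.elim t fun j ↦ b.coord j x - t * b.coord j w)
    (fun o ↦ o.elim w (Function.update b i w)) ?_ ?_ ?_ ?_
  · rintro (_ | j)
    · exact div_nonneg hx hw.le
    · rw [Option.elim_some, sub_nonneg, ht, div_mul_eq_mul_div, div_le_iff₀ hw]
      exact hle j
  · simp only [Fintype.sum_option, Option.elim_none, Option.elim_some, Finset.sum_sub_distrib,
      ← Finset.mul_sum, b.sum_coord_apply_eq_one, mul_one, add_sub_cancel]
  · rintro (_ | j)
    · exact ⟨i, Function.update_self i w b⟩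
    · exact mem_range_self j
  · simp only [Fintype.sum_option, Option.elim_none, Option.elim_some, hcomb,
      Finset.sum_sub_distrib, ← Finset.smul_sum, b.linear_combination_coord_eq_self,
      add_sub_cancel]

lemma convexHull_subset_iUnion_convexHull_range_update
    (hw : w ∈ interior (convexHull ℝ (range b))) :
    convexHull ℝ (range b) ⊆ ⋃ i, convexHull ℝ (range (Function.update b i w)) := by
  intro x hx
  rw [b.convexHull_eq_nonneg_coord] at hx
  rw [b.interior_convexHull] at hw
  have := b.nonempty
  obtain ⟨i, hi⟩ := Finite.exists_min fun i ↦ b.coord i x / b.coord i w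
  exact mem_iUnion.2 ⟨i, mem_convexHull_range_update b (hw i) (hx i) fun j ↦
    (div_le_div_iff₀ (hw i) (hw j)).1 (hi j)⟩

lemma eventually_lineMap_mem_interior_convexHull_range_update
    (hw : w ∈ interior (convexHull ℝ (range b))) (i : ι) :
    ∀ᶠ t : ℝ in 𝓝[>] 1,
      AffineMap.lineMap (b i) w t ∈ interior (convexHull ℝ (range (Function.update b i w))) := by
  have : FiniteDimensional ℝ E := b.finiteDimensional
  rw [b.interior_convexHull] at hw
  let U : Set E := b.coord i ⁻¹' Ioi 0 ∩
    ⋂ j ∈ ({i}ᶜ : Set ι), {x | b.coord i x * b.coord j w < b.coord j x * b.coord i w}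
  have hUopen : IsOpen U :=
    (isOpen_Ioi.preimage (continuous_barycentric_coord b i)).inter <|
      (toFinite _).isOpen_biInter fun j _ ↦ isOpen_lt
        ((continuous_barycentric_coord b i).mul_const _)
        ((continuous_barycentric_coord b j).mul_const _)
  have hUsub : U ⊆ convexHull ℝ (range (Function.update b i w)) := fun x hx ↦ by
    refine mem_convexHull_range_update b (hw i) (le_of_lt hx.1) fun j ↦ ?_
    obtain rfl | hj := eq_or_ne j i
    · rfl
    · exact (mem_iInter₂.1 hx.2 j hj).le
  have hpos : ∀ᶠ t : ℝ in 𝓝 1, 0 < b.coord i (AffineMap.lineMap (b i) w t) := by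
    refine ((continuous_barycentric_coord b i).comp
      AffineMap.lineMap_continuous).continuousAt.eventually_const_lt ?_
    simpa using hw i
  filter_upwards [nhdsWithin_le_nhds hpos, self_mem_nhdsWithin] with t htpos ht
  refine interior_maximal hUsub hUopen ⟨htpos, mem_iInter₂.2 fun j hj ↦ ?_⟩
  have hj' : b.coord j (b i) = 0 := b.coord_apply_ne hj
  simp only [mem_ofPred_eq, AffineMap.apply_lineMap, b.coord_apply_eq, hj',
    AffineMap.lineMap_apply_ring]
  nlinarith [mul_pos (sub_pos.2 ht) (hw j)]

lemma disjoint_interior_convexHull_range_update (hw : w ∈ interior (convexHull ℝ (range b)))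
    {i j : ι} (hij : i ≠ j) :
    Disjoint (interior (convexHull ℝ (range (Function.update b i w))))
      (interior (convexHull ℝ (range (Function.update b j w)))) := by
  have := Fintype.ofFinite ι
  rw [b.interior_convexHull] at hw
  rw [disjoint_iff_inter_eq_empty, ← not_nonempty_iff_eq_empty]
  intro hne
  have heq : EqOn (b.coord j w • b.coord i : E →ᵃ[ℝ] ℝ) (b.coord i w • b.coord j : E →ᵃ[ℝ] ℝ)
      (interior (convexHull ℝ (range (Function.update b i w))) ∩
        interior (convexHull ℝ (range (Function.update b j w)))) := fun x hx ↦
    le_antisymm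
      (coord_mul_coord_le_of_mem_convexHull_range_update b (hw i).le j (interior_subset hx.1))
      (coord_mul_coord_le_of_mem_convexHull_range_update b (hw j).le i (interior_subset hx.2))
  have hmap := AffineMap.ext_on
    ((isOpen_interior.inter isOpen_interior).affineSpan_eq_top hne) heq
  have hbi : b.coord j w * b.coord i (b i) = b.coord i w * b.coord j (b i) :=
    DFunLike.congr_fun hmap (b i)
  rw [b.coord_apply_eq, b.coord_apply_ne hij.symm, mul_one, mul_zero] at hbi
  exact (hw j).ne' hbi

end Subdivision

section Segment

variable {E : Type*} [AddCommGroup E] [Module ℝ E] {a b x y z : E}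

lemma mem_openSegment_lineMap {t : ℝ} (ht : 1 < t) :
    y ∈ openSegment ℝ x (AffineMap.lineMap x y t) := by
  have ht₀ : 0 < t := one_pos.trans ht
  rw [openSegment_eq_image_lineMap]
  refine ⟨t⁻¹, ⟨inv_pos.2 ht₀, inv_lt_one_of_one_lt₀ ht⟩, ?_⟩
  rw [AffineMap.lineMap_lineMap_right, inv_mul_cancel₀ ht₀.ne', AffineMap.lineMap_apply_one]

lemma eventually_lineMap_mem_segment (hy : y ∈ openSegment ℝ x z) :
    ∀ᶠ t : ℝ in 𝓝[>] 1, AffineMap.lineMap x y t ∈ segment ℝ y z := by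
  obtain ⟨s, ⟨hs₀, hs₁⟩, hs⟩ := openSegment_eq_image_lineMap ℝ x z ▸ hy
  filter_upwards [Ioo_mem_nhdsGT (one_lt_one_div hs₀ hs₁)] with t ⟨ht, hts⟩
  have hyt : Wbtw ℝ x y (AffineMap.lineMap x y t) :=
    mem_segment_iff_wbtw.1 (openSegment_subset_segment ℝ _ _ (mem_openSegment_lineMap ht))
  have htz : Wbtw ℝ x (AffineMap.lineMap x y t) z := by
    rw [← hs, AffineMap.lineMap_lineMap_right]
    exact ⟨t * s, ⟨by nlinarith, ((lt_div_iff₀ hs₀).1 hts).le⟩, rfl⟩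
  exact (htz.trans_left_right hyt).mem_segment

lemma mem_segment_or_mem_segment (hy : y ∈ segment ℝ x z) (ha : a ∈ segment ℝ x z) :
    y ∈ segment ℝ x a ∨ a ∈ segment ℝ x y := by
  simp only [mem_segment_iff_wbtw] at *
  exact wbtw_total_of_sameRay_vsub_left <|
    hy.sameRay_vsub_left.trans ha.sameRay_vsub_left.symm fun hz ↦ by
      rw [vsub_eq_zero_iff_eq] at hz
      subst hz
      exact .inl (by rw [(wbtw_self_iff ℝ).1 hy, vsub_self])

lemma mem_openSegment_or_mem_openSegment (hx : x ∈ segment ℝ a b) (hy : y ∈ segment ℝ a b)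
    (hxy : x ≠ y) (hya : y ≠ a) (hyb : y ≠ b) :
    y ∈ openSegment ℝ x a ∨ y ∈ openSegment ℝ x b := by
  obtain hxa | hya' := mem_segment_or_mem_segment hx hy
  · refine .inr (mem_openSegment_of_ne_left_right hxy hyb.symm ?_)
    rw [mem_segment_iff_wbtw] at hy hxa ⊢
    exact hy.trans_left_right hxa
  · exact .inl (mem_openSegment_of_ne_left_right hxy hya.symm (segment_symm ℝ a x ▸ hya'))

end Segment

variable {V : Type*} {G : SimpleGraph V} {p : V → Plane}

section Edges

variable {u v x y : V}

lemma eq_or_eq_of_mem_segment (hD : G.IsStraightLineDrawing p) (hxy : G.Adj x y)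
    (hv : p v ∈ segment ℝ (p x) (p y)) : v = x ∨ v = y :=
  Sym2.mem_iff.1 (hD.2.1 s(x, y) hxy v hv)

lemma exists_common_end (hD : G.IsStraightLineDrawing p) (huv : G.Adj u v) (hxy : G.Adj x y)
    (hne : s(u, v) ≠ s(x, y)) {a : Plane} (ha : a ∈ segment ℝ (p u) (p v))
    (ha' : a ∈ segment ℝ (p x) (p y)) : ∃ w, (w = u ∨ w = v) ∧ (w = x ∨ w = y) ∧ p w = a := by
  obtain ⟨w, ⟨hw, hw'⟩, rfl⟩ := hD.2.2 s(u, v) huv s(x, y) hxy hne ⟨ha, ha'⟩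
  exact ⟨w, Sym2.mem_iff.1 hw, Sym2.mem_iff.1 hw', rfl⟩

end Edges

/-- The filled polygon spanned by the vertices in `f`: for a triangle `f` of a straight-line
drawing, the closed triangular region that it bounds. -/
def face (p : V → Plane) (f : Finset V) : Set Plane :=
  convexHull ℝ (p '' f)

lemma convex_face (f : Finset V) : Convex ℝ (face p f) :=
  convex_convexHull ℝ _

lemma isClosed_face (f : Finset V) : IsClosed (face p f) :=
  (f.finite_toSet.image p).isCompact_convexHull (𝕜 := ℝ) |>.isClosed

lemma mem_face {f : Finset V} {v : V} (hv : v ∈ f) : p v ∈ face p f :=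
  subset_convexHull ℝ _ (mem_image_of_mem p hv)

lemma face_mono {f g : Finset V} (h : f ⊆ g) : face p f ⊆ face p g :=
  convexHull_mono (image_mono (Finset.coe_subset.2 h))

lemma face_subset_face_erase [DecidableEq V] {f : Finset V} {v : V}
    (hv : p v ∈ face p (f.erase v)) : face p f ⊆ face p (f.erase v) := by
  refine convexHull_min (image_subset_iff.2 fun u hu ↦ ?_) (convex_face _)
  obtain rfl | huv := eq_or_ne u v
  exacts [hv, mem_face (Finset.mem_erase.2 ⟨huv, hu⟩)]

lemma affineIndependent_triangle (hD : G.IsStraightLineDrawing p) {f : Finset V}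
    (hf : G.IsNClique 3 f) : AffineIndependent ℝ fun v : f ↦ p v := by
  classical
  obtain ⟨a, b, c, hab, hac, hbc, rfl⟩ := SimpleGraph.is3Clique_iff.1 hf
  have hcol : ¬ Collinear ℝ {p a, p b, p c} := fun h ↦ by
    obtain h | h | h := h.wbtw_or_wbtw_or_wbtw <;> rw [← mem_segment_iff_wbtw] at h
    · exact (eq_or_eq_of_mem_segment hD hac h).elim hab.ne' hbc.ne
    · exact (eq_or_eq_of_mem_segment hD hab.symm h).elim hbc.ne' hac.ne'
    · exact (eq_or_eq_of_mem_segment hD hbc.symm h).elim hac.ne hab.ne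
  have himage : p '' ({a, b, c} : Finset V) = {p a, p b, p c} := by
    simp only [Finset.coe_insert, Finset.coe_singleton, image_insert_eq, image_singleton]
  rw [image_eq_range] at himage
  rw [affineIndependent_iff_not_finrank_vectorSpan_le ℝ _ (n := 1)
    (by rw [Fintype.card_coe, hf.card_eq]), ← collinear_iff_finrank_le_one]
  exact himage ▸ hcol

/-- The corners of a triangle of a straight-line drawing as barycentric reference points. -/
def triangleBasis (hD : G.IsStraightLineDrawing p) {f : Finset V} (hf : G.IsNClique 3 f) :
    AffineBasis f ℝ Plane where
  toFun v := p v
  ind' := affineIndependent_triangle hD hf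
  tot' := (affineIndependent_triangle hD hf).affineSpan_eq_top_iff_card_eq_finrank_add_one.2 <| by
    rw [Fintype.card_coe, hf.card_eq, finrank_euclideanSpace_fin]

section Triangle

variable {f : Finset V} {u v w q : V}

lemma convexHull_range_triangleBasis (hD : G.IsStraightLineDrawing p) (hf : G.IsNClique 3 f) :
    convexHull ℝ (range (triangleBasis hD hf)) = face p f := by
  rw [face, image_eq_range]
  rfl

lemma mem_extremePoints_face (hD : G.IsStraightLineDrawing p) (hf : G.IsNClique 3 f)
    (hv : v ∈ f) : p v ∈ (face p f).extremePoints ℝ := by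
  rw [← convexHull_range_triangleBasis hD hf]
  exact apply_mem_extremePoints (triangleBasis hD hf) ⟨v, hv⟩

lemma interior_face_nonempty (hD : G.IsStraightLineDrawing p) (hf : G.IsNClique 3 f) :
    (interior (face p f)).Nonempty := by
  rw [← convexHull_range_triangleBasis hD hf]
  exact ⟨_, (triangleBasis hD hf).centroid_mem_interior_convexHull⟩

variable [DecidableEq V]

lemma convexHull_image_compl_triangleBasis (hD : G.IsStraightLineDrawing p)
    (hf : G.IsNClique 3 f) (v : f) :
    convexHull ℝ (triangleBasis hD hf '' {v}ᶜ) = face p (f.erase v) := by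
  have himage : triangleBasis hD hf '' {v}ᶜ = p '' (f.erase v) := by
    ext x
    constructor
    · rintro ⟨u, hu, rfl⟩
      exact ⟨u, Finset.mem_erase.2 ⟨fun h ↦ hu (Subtype.ext h), u.2⟩, rfl⟩
    · rintro ⟨u, hu, rfl⟩
      obtain ⟨huv, huf⟩ := Finset.mem_erase.1 hu
      exact ⟨⟨u, huf⟩, fun h ↦ huv (congr_arg Subtype.val h), rfl⟩
  rw [himage, face]

lemma convexHull_range_update_triangleBasis (hD : G.IsStraightLineDrawing p)
    (hf : G.IsNClique 3 f) (w : V) (v : f) :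
    convexHull ℝ (range (Function.update (triangleBasis hD hf) v (p w))) =
      face p (insert w (f.erase v)) := by
  have hrange : range (Function.update (triangleBasis hD hf) v (p w)) =
      p '' (insert w (f.erase v) : Finset V) := by
    ext x
    constructor
    · rintro ⟨u, rfl⟩
      obtain rfl | hu := eq_or_ne u v
      · rw [Function.update_self]
        exact ⟨w, Finset.mem_insert_self _ _, rfl⟩
      · rw [Function.update_of_ne hu]
        exact ⟨u, Finset.mem_insert_of_mem (Finset.mem_erase.2 ⟨Subtype.coe_ne_coe.2 hu, u.2⟩), rfl⟩
    · rintro ⟨u, hu, rfl⟩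
      obtain rfl | hu := Finset.mem_insert.1 hu
      · exact ⟨v, Function.update_self ..⟩
      · obtain ⟨huv, huf⟩ := Finset.mem_erase.1 hu
        exact ⟨⟨u, huf⟩, Function.update_of_ne (fun h ↦ huv (congr_arg Subtype.val h)) ..⟩
  rw [hrange, face]

lemma convexHull_range_update_triangleBasis_erase (hD : G.IsStraightLineDrawing p)
    {K : Finset V} {c : V} (hcK : c ∈ K) (hT : G.IsNClique 3 (K.erase c)) (v : K.erase c) :
    convexHull ℝ (range (Function.update (triangleBasis hD hT) v (p c))) = face p (K.erase v) := by
  rw [convexHull_range_update_triangleBasis, Finset.erase_right_comm, Finset.insert_erase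
    (Finset.mem_erase.2 ⟨(Finset.ne_of_mem_erase v.2).symm, hcK⟩)]

lemma exists_adj_face_erase_eq_segment (hf : G.IsNClique 3 f) (hv : v ∈ f) :
    ∃ x ∈ f, ∃ y ∈ f, G.Adj x y ∧ face p (f.erase v) = segment ℝ (p x) (p y) := by
  obtain ⟨hclique, hcard⟩ := hf.erase_of_mem hv
  obtain ⟨x, y, hxy, herase⟩ := Finset.card_eq_two.1 hcard
  have hx : x ∈ f.erase v := by simp [herase]
  have hy : y ∈ f.erase v := by simp [herase]
  refine ⟨x, Finset.mem_of_mem_erase hx, y, Finset.mem_of_mem_erase hy, hclique hx hy hxy, ?_⟩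
  rw [face, herase, Finset.coe_pair, image_pair, convexHull_pair]

lemma exists_mem_face_erase (hD : G.IsStraightLineDrawing p) (hf : G.IsNClique 3 f) {x : Plane}
    (hx : x ∈ face p f) (hx' : x ∉ interior (face p f)) : ∃ v ∈ f, x ∈ face p (f.erase v) := by
  rw [← convexHull_range_triangleBasis hD hf] at hx hx'
  obtain ⟨v, hv⟩ := exists_mem_convexHull_image_compl _ hx hx'
  exact ⟨v, v.2, convexHull_image_compl_triangleBasis hD hf v ▸ hv⟩

lemma exists_mem_segment_mem_face_erase (hD : G.IsStraightLineDrawing p) (hf : G.IsNClique 3 f)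
    {x y : Plane} (hx : x ∈ face p f) (hy : y ∉ interior (face p f)) :
    ∃ v ∈ f, ∃ z ∈ segment ℝ x y, z ∈ face p (f.erase v) := by
  rw [← convexHull_range_triangleBasis hD hf] at hx hy
  obtain ⟨v, z, hz, hzv⟩ := exists_mem_segment_mem_convexHull_image_compl _ hx hy
  exact ⟨v, v.2, z, hz, convexHull_image_compl_triangleBasis hD hf v ▸ hzv⟩

lemma disjoint_face_erase_interior (hD : G.IsStraightLineDrawing p) (hf : G.IsNClique 3 f)
    (hv : v ∈ f) : Disjoint (face p (f.erase v)) (interior (face p f)) := by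
  have h := disjoint_convexHull_image_compl_interior (triangleBasis hD hf) ⟨v, hv⟩
  rwa [convexHull_image_compl_triangleBasis, convexHull_range_triangleBasis] at h

lemma eq_of_mem_segment_of_mem_face_erase (hD : G.IsStraightLineDrawing p)
    (hf : G.IsNClique 3 f) (hv : v ∈ f) (hw : w ∉ f) (hwq : G.Adj w q) {x : Plane}
    (hx : x ∈ segment ℝ (p w) (p q)) (hxv : x ∈ face p (f.erase v)) : q ∈ f ∧ p q = x := by
  obtain ⟨y, hy, z, hz, hyz, heq⟩ := exists_adj_face_erase_eq_segment (p := p) hf hv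
  have hne : s(w, q) ≠ s(y, z) := fun h ↦ by
    obtain rfl | rfl := Sym2.mem_iff.1 (h ▸ Sym2.mem_mk_left w q)
    exacts [hw hy, hw hz]
  obtain ⟨u, hu, hu', rfl⟩ := exists_common_end hD hwq hyz hne hx (heq ▸ hxv)
  have huf : u ∈ f := by obtain rfl | rfl := hu' <;> assumption
  obtain rfl | rfl := hu
  exacts [absurd huf hw, ⟨huf, rfl⟩]

end Triangle

section EmptyTriangle

variable {f : Finset V} {u v w q : V}

lemma mem_interior_face (hD : G.IsStraightLineDrawing p) (hf : G.IsNClique 3 f) (hw : w ∉ f)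
    (hwf : p w ∈ face p f) : p w ∈ interior (face p f) := by
  classical
  by_contra hw'
  obtain ⟨v, hv, hwv⟩ := exists_mem_face_erase hD hf hwf hw'
  obtain ⟨x, hx, y, hy, hxy, heq⟩ := exists_adj_face_erase_eq_segment (p := p) hf hv
  obtain rfl | rfl := eq_or_eq_of_mem_segment hD hxy (heq ▸ hwv)
  exacts [hw hx, hw hy]

lemma notMem_interior_face (hD : G.IsStraightLineDrawing p) (hf : G.IsNClique 3 f)
    (hv : v ∈ f) : p v ∉ interior (face p f) := by
  classical
  obtain ⟨u, hu, huv⟩ := Finset.exists_mem_ne (by rw [hf.card_eq]; norm_num) v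
  exact Set.disjoint_left.1 (disjoint_face_erase_interior hD hf hu)
    (mem_face (Finset.mem_erase.2 ⟨huv.symm, hv⟩))

lemma mem_of_adj_of_crosses_face (hD : G.IsStraightLineDrawing p) (hf : G.IsNClique 3 f)
    (hw : w ∉ f) (hwq : G.Adj w q) {x y : Plane} (hx : x ∈ segment ℝ (p w) (p q))
    (hy : y ∈ segment ℝ (p w) (p q)) (hxf : x ∈ face p f) (hyf : y ∉ interior (face p f)) :
    q ∈ f ∧ p q ∈ segment ℝ x y := by
  classical
  obtain ⟨v, hv, z, hz, hzv⟩ := exists_mem_segment_mem_face_erase hD hf hxf hyf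
  have hzs := (convex_segment (p w) (p q)).segment_subset hx hy hz
  obtain ⟨hq, rfl⟩ := eq_of_mem_segment_of_mem_face_erase hD hf hv hw hwq hzs hzv
  exact ⟨hq, hz⟩

lemma disjoint_segment_interior_face (hD : G.IsStraightLineDrawing p) (hf : G.IsNClique 3 f)
    (huv : G.Adj u v) (hu : p u ∉ interior (face p f)) (hv : p v ∉ interior (face p f)) :
    Disjoint (segment ℝ (p u) (p v)) (interior (face p f)) := by
  classical
  by_cases hboth : u ∈ f ∧ v ∈ f
  · obtain ⟨x, hx, hxuv⟩ := Finset.exists_mem_notMem_of_card_lt_card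
      (Finset.card_le_two.trans_lt (by rw [hf.card_eq]; norm_num) :
        ({u, v} : Finset V).card < f.card)
    simp only [Finset.mem_insert, Finset.mem_singleton, not_or] at hxuv
    exact (disjoint_face_erase_interior hD hf hx).mono_left <|
      (convex_face _).segment_subset (mem_face (Finset.mem_erase.2 ⟨Ne.symm hxuv.1, hboth.1⟩))
        (mem_face (Finset.mem_erase.2 ⟨Ne.symm hxuv.2, hboth.2⟩))
  wlog huf : u ∉ f generalizing u v
  · rw [segment_symm]
    exact this huv.symm hv hu (fun h ↦ hboth h.symm) fun hvf ↦ hboth ⟨not_not.1 huf, hvf⟩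
  refine Set.disjoint_left.2 fun x hx hxf ↦ hv ?_
  have hvx := (mem_of_adj_of_crosses_face hD hf huf huv hx (left_mem_segment ℝ _ _)
    (interior_subset hxf) hu).2
  rw [segment_symm, mem_segment_iff_wbtw] at hx
  rw [mem_segment_iff_wbtw] at hvx
  rwa [(wbtw_swap_left_iff ℝ _).1 ⟨hx, hvx⟩]

end EmptyTriangle

lemma exists_face_inter_face_sdiff_nonempty [DecidableEq V] (p : V → Plane) {K : Finset V}
    (hK : 3 < K.card) : ∃ A ⊆ K, (face p A ∩ face p (K \ A)).Nonempty := by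
  classical
  have hdep : ¬ AffineIndependent ℝ fun v : K ↦ p v := fun h ↦ by
    have hcard := h.card_le_finrank_succ
    have hdim := Submodule.finrank_le (vectorSpan ℝ (range fun v : K ↦ p v))
    rw [finrank_euclideanSpace_fin] at hdim
    rw [Fintype.card_coe] at hcard
    omega
  obtain ⟨I, x, hxI, hxI'⟩ := Convex.radon_partition hdep
  refine ⟨K.filter (· ∈ Subtype.val '' I), Finset.filter_subset _ _, x,
    convexHull_mono ?_ hxI, convexHull_mono ?_ hxI'⟩
  · rintro _ ⟨v, hv, rfl⟩
    exact ⟨v, Finset.mem_filter.2 ⟨v.2, v, hv, rfl⟩, rfl⟩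
  · rintro _ ⟨v, hv, rfl⟩
    refine ⟨v, Finset.mem_sdiff.2 ⟨v.2, fun h ↦ ?_⟩, rfl⟩
    obtain ⟨u, hu, huv⟩ := (Finset.mem_filter.1 h).2
    exact hv (Subtype.ext huv ▸ hu)

lemma disjoint_face_of_isNClique_two (hD : G.IsStraightLineDrawing p)
    {A B : Finset V} (hA : G.IsNClique 2 A) (hB : G.IsNClique 2 B) (hAB : Disjoint A B) :
    Disjoint (face p A) (face p B) := by
  classical
  obtain ⟨a, a', ha, rfl⟩ := Finset.card_eq_two.1 hA.card_eq
  obtain ⟨b, b', hb, rfl⟩ := Finset.card_eq_two.1 hB.card_eq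
  have haa' : G.Adj a a' := hA.isClique (by simp) (by simp) ha
  have hbb' : G.Adj b b' := hB.isClique (by simp) (by simp) hb
  simp only [face, Finset.coe_pair, image_pair, convexHull_pair]
  refine Set.disjoint_left.2 fun x hxa hxb ↦ ?_
  have hne : s(a, a') ≠ s(b, b') := fun h ↦ by
    have hab : a ∈ s(b, b') := h ▸ Sym2.mem_mk_left a a'
    exact Finset.disjoint_left.1 hAB (Finset.mem_insert_self a _) (by simpa using hab)
  obtain ⟨w, hwa, hwb, -⟩ := exists_common_end hD haa' hbb' hne hxa hxb
  exact Finset.disjoint_left.1 hAB (by simpa using hwa) (by simpa using hwb)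

lemma exists_mem_interior_face_erase [DecidableEq V] (hD : G.IsStraightLineDrawing p)
    {K : Finset V} (hK : G.IsNClique 4 K) : ∃ c ∈ K, p c ∈ interior (face p (K.erase c)) := by
  obtain ⟨A, hAK, hA⟩ : ∃ A ⊆ K, (face p A ∩ face p (K \ A)).Nonempty :=
    exists_face_inter_face_sdiff_nonempty p (by rw [hK.card_eq]; norm_num)
  wlog hle : A.card ≤ (K \ A).card generalizing A
  · exact this (K \ A) Finset.sdiff_subset
      (by rwa [Finset.sdiff_sdiff_eq_self hAK, inter_comm])
      (by rw [Finset.sdiff_sdiff_eq_self hAK]; exact (not_le.1 hle).le)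
  have hcard := Finset.card_sdiff_add_card_eq_card hAK
  rw [hK.card_eq] at hcard
  have hA₀ : A.card ≠ 0 := fun h ↦ by
    simp [Finset.card_eq_zero.1 h, face] at hA
  obtain hA₁ | hA₂ : A.card = 1 ∨ A.card = 2 := by omega
  · obtain ⟨c, rfl⟩ := Finset.card_eq_one.1 hA₁
    have hc : c ∈ K := Finset.singleton_subset_iff.1 hAK
    rw [Finset.sdiff_singleton_eq_erase] at hA
    obtain ⟨x, hxc, hx⟩ := hA
    rw [face, Finset.coe_singleton, image_singleton, convexHull_singleton] at hxc
    exact ⟨c, hc, mem_interior_face hD (hK.erase_of_mem hc) (Finset.notMem_erase c K)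
      (mem_singleton_iff.1 hxc ▸ hx)⟩
  · refine absurd (disjoint_face_of_isNClique_two hD
      ⟨hK.isClique.subset hAK, hA₂⟩
      ⟨hK.isClique.subset Finset.sdiff_subset, by omega⟩
      Finset.disjoint_sdiff) (not_disjoint_iff_nonempty_inter.2 hA)

/-- The prolongation of the directed edge `d` beyond its end `d.2` starts in the interior of the
triangle `f`. -/
def Enters (p : V → Plane) (d : V × V) (f : Finset V) : Prop :=
  ∀ᶠ t in 𝓝[>] (1 : ℝ), AffineMap.lineMap (p d.1) (p d.2) t ∈ interior (face p f)

/-- The triangles in `F` are the inner faces, and `T` is the outer face, of the drawing `p` of the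
subgraph of `G` induced on `S`. That the faces number `2 * #S - 5` and that each of them is entered
by an edge are recorded here because both are preserved when a face is refined. -/
structure IsTriangulation (G : SimpleGraph V) (p : V → Plane) (S T : Finset V)
    (F : Finset (Finset V)) : Prop where
  isNClique_outer : G.IsNClique 3 T
  outer_subset : T ⊆ S
  mem_outer : ∀ v ∈ S, p v ∈ face p T
  card_add_five : F.card + 5 = 2 * S.card
  isNClique : ∀ f ∈ F, G.IsNClique 3 f
  subset : ∀ f ∈ F, f ⊆ S
  outer_subset_iUnion : face p T ⊆ ⋃ f ∈ F, face p f
  notMem_interior : ∀ f ∈ F, ∀ v ∈ S, p v ∉ interior (face p f)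
  pairwiseDisjoint : (F : Set (Finset V)).PairwiseDisjoint fun f ↦ interior (face p f)
  exists_enters : ∀ f ∈ F, ∃ d : V × V, G.Adj d.1 d.2 ∧ Enters p d f

namespace IsTriangulation

variable {S S' T f : Finset V} {F F' : Finset (Finset V)}

lemma face_subset_outer (h : IsTriangulation G p S T F) (hf : f ∈ F) : face p f ⊆ face p T :=
  convexHull_min (image_subset_iff.2 fun v hv ↦ h.mem_outer v (h.subset f hf hv)) (convex_face T)

lemma notMem_of_disjoint_interior_outer (hD : G.IsStraightLineDrawing p)
    (h : IsTriangulation G p S T F) {U : Set Plane} (hU : IsOpen U)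
    (hdisj : Disjoint U (interior (face p T))) {v : V} (hv : v ∈ S) : p v ∉ U := by
  have hclosure : closure (interior (face p T)) = face p T := by
    rw [(convex_face T).closure_interior_eq_closure_of_nonempty_interior
      (interior_face_nonempty hD h.isNClique_outer), (isClosed_face T).closure_eq]
  exact fun hvU ↦ Set.disjoint_left.1 (hclosure ▸ hdisj.closure_right hU) hvU (h.mem_outer v hv)

variable [DecidableEq V]

lemma of_isNClique_four (hD : G.IsStraightLineDrawing p) {K : Finset V} (hK : G.IsNClique 4 K)
    {c : V} (hcK : c ∈ K) (hc : p c ∈ interior (face p (K.erase c))) :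
    IsTriangulation G p K (K.erase c) ((K.erase c).image K.erase) := by
  have hT : G.IsNClique 3 (K.erase c) := hK.erase_of_mem hcK
  have hsub : face p K ⊆ face p (K.erase c) := face_subset_face_erase (interior_subset hc)
  rw [← convexHull_range_triangleBasis hD hT] at hc
  have hcover := convexHull_subset_iUnion_convexHull_range_update _ hc
  have hdisj {v u : K.erase c} (hvu : v ≠ u) :=
    disjoint_interior_convexHull_range_update _ hc hvu
  have henters (v : K.erase c) :=
    eventually_lineMap_mem_interior_convexHull_range_update _ hc v
  simp only [convexHull_range_update_triangleBasis_erase hD hcK, iUnion_subtype,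
    convexHull_range_triangleBasis] at hcover hdisj henters
  refine
    { isNClique_outer := hT
      outer_subset := Finset.erase_subset c K
      mem_outer := fun v hv ↦ hsub (mem_face hv)
      card_add_five := ?_
      isNClique := Finset.forall_mem_image.2 fun v hv ↦ hK.erase_of_mem (Finset.mem_of_mem_erase hv)
      subset := Finset.forall_mem_image.2 fun v _ ↦ Finset.erase_subset v K
      outer_subset_iUnion := by rwa [Finset.set_biUnion_finset_image]
      notMem_interior := Finset.forall_mem_image.2 fun v hv u hu ↦ ?_
      pairwiseDisjoint := ?_
      exists_enters := Finset.forall_mem_image.2 fun v hv ↦ ⟨(v, c), ?_, henters ⟨v, hv⟩⟩ }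
  · rw [Finset.card_image_of_injOn (K.erase_injOn.mono (Finset.erase_subset c K)), hT.card_eq,
      hK.card_eq]
  · obtain rfl | huv := eq_or_ne u v
    · exact fun h ↦ notMem_interior_face hD hT hv
        (interior_mono ((face_mono (Finset.erase_subset u K)).trans hsub) h)
    · exact notMem_interior_face hD (hK.erase_of_mem (Finset.mem_of_mem_erase hv))
        (Finset.mem_erase.2 ⟨huv, hu⟩)
  · rw [Finset.coe_image]
    rintro _ ⟨v, hv, rfl⟩ _ ⟨u, hu, rfl⟩ hne
    exact hdisj (v := ⟨v, hv⟩) (u := ⟨u, hu⟩) (ne_of_apply_ne (fun x : K.erase c ↦ K.erase x) hne)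
  · exact hK.isClique (Finset.mem_of_mem_erase hv) hcK (Finset.ne_of_mem_erase hv)

lemma disjoint_erase_faces (hD : G.IsStraightLineDrawing p) (h : IsTriangulation G p S T F)
    (hf : f ∈ F) (h' : IsTriangulation G p S' f F') : Disjoint (F.erase f) F' := by
  refine Finset.disjoint_left.2 fun g hg hg' ↦ ?_
  have hdisj := h.pairwiseDisjoint (Finset.mem_of_mem_erase hg) hf (Finset.ne_of_mem_erase hg)
  exact (interior_face_nonempty hD (h'.isNClique g hg')).not_subset_empty
    (hdisj Subset.rfl (interior_mono (h'.face_subset_outer hg')))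

lemma card_refine_face_add_five (hD : G.IsStraightLineDrawing p) (h : IsTriangulation G p S T F)
    (hf : f ∈ F) (h' : IsTriangulation G p S' f F') (hS : S ∩ S' = f) :
    (F.erase f ∪ F').card + 5 = 2 * (S ∪ S').card := by
  have hcardS := Finset.card_union_add_card_inter S S'
  rw [hS, h'.isNClique_outer.card_eq] at hcardS
  have hcardF := Finset.card_erase_add_one hf
  have hFS := h.card_add_five
  have hFS' := h'.card_add_five
  rw [Finset.card_union_of_disjoint (h.disjoint_erase_faces hD hf h')]
  omega

lemma refine_face (hD : G.IsStraightLineDrawing p) (h : IsTriangulation G p S T F) (hf : f ∈ F)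
    (h' : IsTriangulation G p S' f F') (hS : S ∩ S' = f) :
    IsTriangulation G p (S ∪ S') T (F.erase f ∪ F') := by
  have hsub {g : Finset V} (hg : g ∈ F') : interior (face p g) ⊆ interior (face p f) :=
    interior_mono (h'.face_subset_outer hg)
  have hdisj {g : Finset V} (hg : g ∈ F.erase f) :
      Disjoint (interior (face p g)) (interior (face p f)) :=
    h.pairwiseDisjoint (Finset.mem_of_mem_erase hg) hf (Finset.ne_of_mem_erase hg)
  refine
    { isNClique_outer := h.isNClique_outer
      outer_subset := h.outer_subset.trans Finset.subset_union_left
      mem_outer := Finset.forall_mem_union.2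
        ⟨h.mem_outer, fun v hv ↦ h.face_subset_outer hf (h'.mem_outer v hv)⟩
      card_add_five := h.card_refine_face_add_five hD hf h' hS
      isNClique := Finset.forall_mem_union.2
        ⟨fun g hg ↦ h.isNClique g (Finset.mem_of_mem_erase hg), h'.isNClique⟩
      subset := Finset.forall_mem_union.2
        ⟨fun g hg ↦ (h.subset g (Finset.mem_of_mem_erase hg)).trans Finset.subset_union_left,
          fun g hg ↦ (h'.subset g hg).trans Finset.subset_union_right⟩
      outer_subset_iUnion := ?_
      notMem_interior := Finset.forall_mem_union.2
        ⟨fun g hg ↦ Finset.forall_mem_union.2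
            ⟨h.notMem_interior g (Finset.mem_of_mem_erase hg), fun v ↦
              h'.notMem_of_disjoint_interior_outer hD isOpen_interior (hdisj hg)⟩,
          fun g hg ↦ Finset.forall_mem_union.2
            ⟨fun v hv hvg ↦ h.notMem_interior f hf v hv (hsub hg hvg), h'.notMem_interior g hg⟩⟩
      pairwiseDisjoint := ?_
      exists_enters := Finset.forall_mem_union.2
        ⟨fun g hg ↦ h.exists_enters g (Finset.mem_of_mem_erase hg), h'.exists_enters⟩ }
  · rw [Finset.set_biUnion_union, union_comm]
    refine h.outer_subset_iUnion.trans ?_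
    rw [← Finset.insert_erase hf, Finset.set_biUnion_insert, Finset.insert_erase hf]
    exact union_subset_union_left _ h'.outer_subset_iUnion
  · rw [Finset.coe_union, Set.pairwiseDisjoint_union]
    exact ⟨h.pairwiseDisjoint.subset (Finset.coe_subset.2 (F.erase_subset f)), h'.pairwiseDisjoint,
      fun g hg g' hg' _ ↦ (hdisj hg).mono_right (hsub hg')⟩

end IsTriangulation

/-- The vertex set `S` arises from an `(m + 1)`-clique of `G` by repeatedly adding a vertex whose
neighbours among the previous ones form an `m`-clique. -/
inductive IsStacked (m : ℕ) (G : SimpleGraph V) [DecidableEq V] : Finset V → Prop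
  | clique {S : Finset V} (hS : G.IsNClique (m + 1) S) : IsStacked m G S
  | stack {S Q : Finset V} {w : V} (hS : IsStacked m G S) (hw : w ∉ S) (hQS : Q ⊆ S)
    (hQ : G.IsNClique m Q) (hadj : ∀ u ∈ S, G.Adj w u ↔ u ∈ Q) : IsStacked m G (insert w S)

section Stacked

variable [DecidableEq V]

lemma isStacked_univ [Fintype V] {m : ℕ} (hG : G.IsKTree m) : IsStacked m G Finset.univ := by
  obtain ⟨hcard, σ, hbase, hstack⟩ := hG
  let first (j : ℕ) : Finset V :=
    (Finset.univ.filter fun i : Fin (Fintype.card V) ↦ i.val < j).map σ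
  have mem_first {j : ℕ} {i : Fin (Fintype.card V)} : σ i ∈ first j ↔ i.val < j := by
    simp [first]
  suffices hfirst : ∀ j, m + 1 ≤ j → j ≤ Fintype.card V → IsStacked m G (first j) by
    convert hfirst _ hcard le_rfl
    simp [first]
  intro j hj
  induction j, hj using Nat.le_induction with
  | base =>
    refine fun hm ↦ .clique ⟨?_, ?_⟩
    · simpa [first] using hbase
    · rw [Finset.card_map, Fin.card_filter_val_lt, min_eq_right hm]
  | succ j hj ih =>
    intro hjV
    obtain ⟨Q, hQ, hneighbors⟩ := hstack ⟨j, hjV⟩ hj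
    have mem_Q {u : V} : u ∈ Q ↔ G.Adj (σ ⟨j, hjV⟩) u ∧ u ∈ first j := by
      rw [← Finset.mem_coe, ← hneighbors]
      simp [first, Fin.lt_def]
    have hsucc : first (j + 1) = insert (σ ⟨j, hjV⟩) (first j) := by
      ext u
      obtain ⟨i, rfl⟩ := σ.surjective u
      simp [mem_first, Fin.ext_iff, le_iff_eq_or_lt]
    rw [hsucc]
    exact .stack (ih (by omega)) (by simp [mem_first]) (fun u hu ↦ (mem_Q.1 hu).2) hQ
      fun u hu ↦ (mem_Q.trans (and_iff_left hu)).symm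

lemma exists_isTriangulation_insert (hD : G.IsStraightLineDrawing p) {S T Q : Finset V}
    {F : Finset (Finset V)} (h : IsTriangulation G p S T F) {w : V} (hw : w ∉ S) (hQS : Q ⊆ S)
    (hQ : G.IsNClique 3 Q) (hadj : ∀ q ∈ Q, G.Adj w q) :
    ∃ T' F', IsTriangulation G p (insert w S) T' F' := by
  have hwQ : w ∉ Q := fun hwQ ↦ hw (hQS hwQ)
  have hK : G.IsNClique 4 (insert w Q) := hQ.insert hadj
  have hKw : (insert w Q).erase w = Q := Finset.erase_insert hwQ
  have hinter : S ∩ insert w Q = Q := by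
    rw [Finset.inter_insert_of_notMem hw, Finset.inter_eq_right.2 hQS]
  have hunion : S ∪ insert w Q = insert w S := by
    rw [Finset.union_insert, Finset.union_eq_left.2 hQS]
  by_cases hwT : p w ∈ face p T
  · obtain ⟨f, hf, hwf⟩ := mem_iUnion₂.1 (h.outer_subset_iUnion hwT)
    have hQf : Q ⊆ f := fun q hq ↦ (mem_of_adj_of_crosses_face hD (h.isNClique f hf)
      (fun hwf ↦ hw (h.subset f hf hwf)) (hadj q hq) (left_mem_segment ℝ _ _)
      (right_mem_segment ℝ _ _) hwf (h.notMem_interior f hf q (hQS hq))).1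
    obtain rfl := Finset.eq_of_subset_of_card_le hQf
      (by rw [(h.isNClique f hf).card_eq, hQ.card_eq])
    have hinner := IsTriangulation.of_isNClique_four hD hK (Finset.mem_insert_self w Q)
      (by rw [hKw]; exact mem_interior_face hD hQ hwQ hwf)
    rw [hKw] at hinner
    exact hunion ▸ ⟨_, _, h.refine_face hD hf hinner hinter⟩
  · have hQT : Q ⊆ T := fun q hq ↦ (mem_of_adj_of_crosses_face hD h.isNClique_outer
      (fun hwT ↦ hw (h.outer_subset hwT)) (hadj q hq) (right_mem_segment ℝ _ _)
      (left_mem_segment ℝ _ _) (h.mem_outer q (hQS hq)) fun hw ↦ hwT (interior_subset hw)).1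
    obtain rfl := Finset.eq_of_subset_of_card_le hQT
      (by rw [h.isNClique_outer.card_eq, hQ.card_eq])
    obtain ⟨c, hcK, hc⟩ := exists_mem_interior_face_erase hD hK
    have hwc : w ≠ c := by
      rintro rfl
      exact hwT (hKw ▸ interior_subset hc)
    have houter := IsTriangulation.of_isNClique_four hD hK hcK hc
    have hface := Finset.mem_image_of_mem (insert w Q).erase
      (Finset.mem_erase.2 ⟨hwc, Finset.mem_insert_self w Q⟩)
    rw [hKw] at hface
    rw [← hunion, Finset.union_comm]
    exact ⟨_, _, houter.refine_face hD hface h (by rw [Finset.inter_comm, hinter])⟩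

lemma exists_isTriangulation (hD : G.IsStraightLineDrawing p) {S : Finset V}
    (hS : IsStacked 3 G S) : ∃ T F, IsTriangulation G p S T F := by
  induction hS with
  | clique hS =>
    obtain ⟨c, hcS, hc⟩ := exists_mem_interior_face_erase hD hS
    exact ⟨_, _, .of_isNClique_four hD hS hcS hc⟩
  | stack _ hw hQS hQ hadj ih =>
    obtain ⟨T, F, h⟩ := ih
    exact exists_isTriangulation_insert hD h hw hQS hQ fun q hq ↦ (hadj q (hQS hq)).2 hq

end Stacked

section Degree

variable [DecidableEq V] {S K : Finset V} {w : V}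

lemma lt_card_of_isStacked {m : ℕ} (hS : IsStacked m G S) : m < S.card := by
  induction hS with
  | clique hS => exact hS.card_eq ▸ m.lt_succ_self
  | stack _ _ _ _ _ ih => exact ih.trans_le (Finset.card_le_card (Finset.subset_insert _ _))

variable [DecidableRel G.Adj]

lemma card_interedges_insert_left (hw : w ∉ S) :
    (G.interedges (insert w S) K).card =
      (K.filter (G.Adj w)).card + (G.interedges S K).card := by
  have hinsert : G.interedges (insert w S) K =
      (K.filter (G.Adj w)).image (Prod.mk w) ∪ G.interedges S K := by
    ext ⟨x, y⟩
    simp only [SimpleGraph.mem_interedges_iff, Finset.mem_insert, Finset.mem_union,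
      Finset.mem_image, Finset.mem_filter, Prod.mk.injEq]
    aesop
  rw [hinsert, Finset.card_union_of_disjoint,
    Finset.card_image_of_injective _ (Prod.mk_right_injective w)]
  refine Finset.disjoint_left.2 fun d hd hdS ↦ ?_
  obtain ⟨u, -, rfl⟩ := Finset.mem_image.1 hd
  exact hw (G.mem_interedges_iff.1 hdS).1

lemma card_interedges_insert_right (hw : w ∉ K) :
    (G.interedges S (insert w K)).card =
      (S.filter (G.Adj w)).card + (G.interedges S K).card := by
  have hcomm (A B : Finset V) : (G.interedges A B).card = (G.interedges B A).card :=
    have := G.symm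
    Rel.card_interedges_comm A B
  rw [hcomm, card_interedges_insert_left hw, hcomm]

omit [DecidableEq V] in
lemma card_interedges_of_isNClique {m : ℕ} (hS : G.IsNClique (m + 1) S) (hK : K ⊆ S) :
    (G.interedges S K).card = m * K.card := by
  classical
  induction K using Finset.induction_on with
  | empty => simp [SimpleGraph.interedges, Rel.interedges]
  | insert v K hv ih =>
    have hneighbors : S.filter (G.Adj v) = S.erase v := by
      ext u
      rw [Finset.mem_filter, Finset.mem_erase, and_comm]
      exact and_congr_left fun hu ↦
        ⟨fun h ↦ h.ne', fun h ↦ hS.isClique (hK (Finset.mem_insert_self v K)) hu h.symm⟩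
    rw [card_interedges_insert_right hv, ih ((Finset.subset_insert v K).trans hK), hneighbors,
      (hS.erase_of_mem (hK (Finset.mem_insert_self v K))).card_eq, Finset.card_insert_of_notMem hv,
      Nat.add_sub_cancel, mul_add_one, add_comm]

-- A vertex stacked on an `m`-clique `Q ⊆ S` outside `K ⊆ S` has at least `#K + m - #S` neighbours
-- in `K`, namely those in `K ∩ Q`; for `#S = m + 1 + i` this is the `i`-th term of the sum.
lemma mul_card_add_sum_le_card_interedges {m : ℕ} (hS : IsStacked m G S) (hK : G.IsClique K)
    (hKS : K ⊆ S) :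
    m * K.card + ∑ i ∈ Finset.range (S.card - (m + 1)), (K.card - 1 - i) ≤
      (G.interedges S K).card := by
  induction hS generalizing K with
  | clique hS => simp [card_interedges_of_isNClique hS hKS, hS.card_eq]
  | @stack S Q w hS hw hQS hQ hadj ih =>
    have hmS := lt_card_of_isStacked hS
    have hSm : (insert w S).card - (m + 1) = S.card - (m + 1) + 1 := by
      rw [Finset.card_insert_of_notMem hw]
      omega
    have filter_adj {A : Finset V} (hA : A ⊆ S) : A.filter (G.Adj w) = A ∩ Q := by
      ext u
      rw [Finset.mem_filter, Finset.mem_inter]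
      exact and_congr_right fun hu ↦ hadj u (hA hu)
    rw [hSm, card_interedges_insert_left hw]
    by_cases hwK : w ∈ K
    · obtain ⟨K', hwK', rfl⟩ : ∃ K', w ∉ K' ∧ insert w K' = K :=
        ⟨K.erase w, Finset.notMem_erase w K, Finset.insert_erase hwK⟩
      have hKS' : K' ⊆ S := (Finset.insert_subset_insert_iff hwK').1 hKS
      have hwAdj : ∀ u ∈ K', G.Adj w u := fun u hu ↦
        hK hwK (Finset.mem_insert_of_mem hu) (ne_of_mem_of_not_mem hu hwK').symm
      have hIH := ih (hK.subset (Finset.subset_insert w K')) hKS'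
      rw [Finset.filter_insert, if_neg G.irrefl, Finset.filter_true_of_mem hwAdj,
        card_interedges_insert_right hwK', filter_adj Subset.rfl, Finset.inter_eq_right.2 hQS,
        hQ.card_eq, Finset.sum_range_succ', Finset.card_insert_of_notMem hwK']
      simp only [Nat.add_sub_cancel, Nat.sub_zero, Nat.sub_sub, mul_add_one, add_comm 1] at hIH ⊢
      omega
    · have hKS : K ⊆ S := (Finset.subset_insert_iff_of_notMem hwK).1 hKS
      have hunion := Finset.card_le_card (Finset.union_subset hKS hQS)
      have hinter := Finset.card_union_add_card_inter K Q
      rw [hQ.card_eq] at hinter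
      rw [Finset.sum_range_succ, filter_adj hKS]
      have := ih hK hKS
      omega

lemma twelve_le_card_interedges (hS : IsStacked 3 G S) (hK : G.IsNClique 3 K) (hKS : K ⊆ S)
    (hcard : 6 ≤ S.card) : 12 ≤ (G.interedges S K).card := by
  have hle := mul_card_add_sum_le_card_interedges hS hK.isClique hKS
  have hsum : ∑ i ∈ Finset.range 2, (K.card - 1 - i) ≤
      ∑ i ∈ Finset.range (S.card - (3 + 1)), (K.card - 1 - i) :=
    Finset.sum_le_sum_of_subset (Finset.range_mono (by omega))
  rw [Finset.sum_range_succ, Finset.sum_range_one, hK.card_eq] at hsum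
  rw [hK.card_eq] at hle
  omega

end Degree

/-- The directed edge `d` ends a straight run of edges: no edge at `d.2` continues it straight. The
continuation is expressed by `p d.2` lying between `p d.1` and the other end of that edge. -/
def IsPort (G : SimpleGraph V) (p : V → Plane) (d : V × V) : Prop :=
  G.Adj d.1 d.2 ∧ ∀ u, G.Adj d.2 u → p d.2 ∉ segment ℝ (p d.1) (p u)

section Port

variable {d : V × V} {a b : Plane}

lemma isPort_of_mem_extremePoints (hp : Function.Injective p) {C : Set Plane}
    (hC : ∀ v, p v ∈ C) (hd : G.Adj d.1 d.2) (hext : p d.2 ∈ C.extremePoints ℝ) : IsPort G p d := by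
  refine ⟨hd, fun u hu hseg ↦ ?_⟩
  obtain h | h := (mem_extremePoints_iff_forall_segment.1 hext).2 _ (hC d.1) _ (hC u) hseg
  exacts [hd.ne (hp h), hu.ne' (hp h)]

lemma Enters.isPort (hD : G.IsStraightLineDrawing p) {f : Finset V} (hf : G.IsNClique 3 f)
    (hempty : ∀ v, p v ∉ interior (face p f)) (hd : G.Adj d.1 d.2) (henters : Enters p d f) :
    IsPort G p d := by
  classical
  refine ⟨hd, fun u hu hseg ↦ ?_⟩
  have hopen := mem_openSegment_of_ne_left_right (hD.1.ne hd.ne) (hD.1.ne hu.ne') hseg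
  obtain ⟨t, htu, htf⟩ := ((eventually_lineMap_mem_segment hopen).and henters).exists
  exact Set.disjoint_left.1
    (disjoint_segment_interior_face hD hf hu (hempty d.2) (hempty u)) htu htf

lemma Enters.notMem_extremePoints (hp : Function.Injective p) {f : Finset V} {C : Set Plane}
    (hd : G.Adj d.1 d.2) (henters : Enters p d f) (hC : p d.1 ∈ C) (hfC : face p f ⊆ C) :
    p d.2 ∉ C.extremePoints ℝ := by
  intro hext
  obtain ⟨t, htf, ht⟩ := (henters.and self_mem_nhdsWithin).exists
  exact hd.ne (hp (hext.2 hC (hfC (interior_subset htf)) (mem_openSegment_lineMap ht)))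

lemma Enters.not_disjoint {f g : Finset V} (hf : Enters p d f) (hg : Enters p d g) :
    ¬ Disjoint (interior (face p f)) (interior (face p g)) := by
  obtain ⟨t, htf, htg⟩ := (hf.and hg).exists
  exact not_disjoint_iff.2 ⟨_, htf, htg⟩

lemma isClosed_edgeSegment (p : V → Plane) (e : Sym2 V) :
    IsClosed (SimpleGraph.edgeSegment p e) := by
  induction e with
  | h x y =>
    change IsClosed (segment ℝ (p x) (p y))
    rw [← convexHull_pair]
    exact ((toFinite {p x, p y}).isCompact_convexHull (𝕜 := ℝ)).isClosed

lemma exists_adj_of_frequently_mem_edgeSegment (hD : G.IsStraightLineDrawing p)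
    (hd : G.Adj d.1 d.2) {e : Sym2 V} (he : e ∈ G.edgeSet)
    (hfreq : ∃ᶠ t in 𝓝[>] (1 : ℝ),
      AffineMap.lineMap (p d.1) (p d.2) t ∈ SimpleGraph.edgeSegment p e) :
    ∃ u, G.Adj d.2 u ∧ p d.2 ∈ segment ℝ (p d.1) (p u) := by
  have htendsto : Tendsto (AffineMap.lineMap (p d.1) (p d.2)) (𝓝[>] (1 : ℝ)) (𝓝 (p d.2)) := by
    have hcont : Continuous (AffineMap.lineMap (k := ℝ) (p d.1) (p d.2)) :=
      AffineMap.lineMap_continuous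
    simpa using (hcont.tendsto 1).mono_left nhdsWithin_le_nhds
  obtain ⟨u, rfl⟩ := hD.2.1 e he d.2 <|
    (isClosed_edgeSegment p e).mem_of_frequently_of_tendsto hfreq htendsto
  obtain ⟨t, htu, ht⟩ := (hfreq.and_eventually self_mem_nhdsWithin).exists
  have hprolong := mem_openSegment_lineMap (x := p d.1) (y := p d.2) ht
  have hne : p d.2 ≠ AffineMap.lineMap (p d.1) (p d.2) t := fun h ↦
    ht.ne (AffineMap.lineMap_injective ℝ (hD.1.ne hd.ne) (by rwa [AffineMap.lineMap_apply_one]))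
  have hwbtw := mem_segment_iff_wbtw.1 (openSegment_subset_segment ℝ _ _ hprolong)
  exact ⟨u, he, (hwbtw.trans_expand_left (mem_segment_iff_wbtw.1 htu) hne).mem_segment⟩

lemma IsPort.eq_or_eq [Finite V] (hD : G.IsStraightLineDrawing p) (hd : IsPort G p d)
    {S : Set (Sym2 V)} (hSG : S ⊆ G.edgeSet)
    (hS : ⋃ e ∈ S, SimpleGraph.edgeSegment p e = segment ℝ a b) (hdS : s(d.1, d.2) ∈ S) :
    p d.2 = a ∨ p d.2 = b := by
  by_contra! hne
  have hsub : segment ℝ (p d.1) (p d.2) ⊆ segment ℝ a b :=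
    hS ▸ subset_biUnion_of_mem (u := SimpleGraph.edgeSegment p) hdS
  have hright := hsub (right_mem_segment ℝ _ _)
  have hprolong : ∀ᶠ t in 𝓝[>] (1 : ℝ),
      AffineMap.lineMap (p d.1) (p d.2) t ∈ ⋃ e ∈ S, SimpleGraph.edgeSegment p e := by
    rw [hS]
    obtain h | h := mem_openSegment_or_mem_openSegment (hsub (left_mem_segment ℝ _ _)) hright
      (hD.1.ne hd.1.ne) hne.1 hne.2
    · exact (eventually_lineMap_mem_segment h).mono fun t ht ↦
        (convex_segment a b).segment_subset hright (left_mem_segment ℝ a b) ht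
    · exact (eventually_lineMap_mem_segment h).mono fun t ht ↦
        (convex_segment a b).segment_subset hright (right_mem_segment ℝ a b) ht
  simp only [mem_iUnion₂, exists_prop] at hprolong
  obtain ⟨e, heS, he⟩ := (toFinite S).frequently_exists.1 hprolong.frequently
  obtain ⟨u, hu, hdu⟩ := exists_adj_of_frequently_mem_edgeSegment hD hd.1 (hSG heS) he
  exact hd.2 u hu hdu

lemma eq_of_mem_segment_of_mem_segment (hD : G.IsStraightLineDrawing p) {x y v : V}
    (hx : G.Adj x v) (hy : G.Adj y v) (hxb : p x ∈ segment ℝ (p v) b)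
    (hyb : p y ∈ segment ℝ (p v) b) : x = y := by
  obtain h | h := mem_segment_or_mem_segment hxb hyb
  · exact (eq_or_eq_of_mem_segment hD hy.symm h).resolve_left hx.ne
  · exact ((eq_or_eq_of_mem_segment hD hx.symm h).resolve_left hy.ne).symm

lemma exists_mem_drawingSegments [Finite V] (hp : Function.Injective p) (hd : G.Adj d.1 d.2) :
    ∃ S ∈ G.drawingSegments p, s(d.1, d.2) ∈ S := by
  have hform : G.FormsSegment p {s(d.1, d.2)} :=
    ⟨singleton_subset_iff.2 hd, p d.1, p d.2, hp.ne hd.ne, biUnion_singleton _ _⟩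
  obtain ⟨S, hdS, hS⟩ := (toFinite {S | G.FormsSegment p S}).exists_le_maximal hform
  exact ⟨S, hS, hdS rfl⟩

lemma card_isPort_le_two [Finite V] (hD : G.IsStraightLineDrawing p) {S : Set (Sym2 V)}
    (hS : G.FormsSegment p S) {D : Finset (V × V)}
    (hport : ∀ d ∈ D, IsPort G p d ∧ s(d.1, d.2) ∈ S) : D.card ≤ 2 := by
  classical
  obtain ⟨hSG, a, b, -, hunion⟩ := hS
  have hend : ∀ d ∈ D, p d.2 = a ∨ p d.2 = b := fun d hd ↦
    (hport d hd).1.eq_or_eq hD hSG hunion (hport d hd).2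
  have hstart : ∀ d ∈ D, p d.1 ∈ segment ℝ a b := fun d hd ↦
    hunion ▸ mem_biUnion (t := SimpleGraph.edgeSegment p) (hport d hd).2 (left_mem_segment ℝ _ _)
  refine le_trans (Finset.card_le_card_of_injOn (t := {a, b}) (fun d ↦ p d.2) ?_ ?_)
    Finset.card_le_two
  · exact fun d hd ↦ by simpa using hend d hd
  · rintro ⟨x, v⟩ hx ⟨y, u⟩ hy heq
    obtain rfl : v = u := hD.1 heq
    have hxS := hstart _ hx
    have hyS := hstart _ hy
    rw [Prod.mk.injEq, and_iff_left rfl]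
    obtain rfl | rfl := hend _ hx
    · exact eq_of_mem_segment_of_mem_segment hD (hport _ hx).1.1 (hport _ hy).1.1 hxS hyS
    · rw [segment_symm] at hxS hyS
      exact eq_of_mem_segment_of_mem_segment hD (hport _ hx).1.1 (hport _ hy).1.1 hxS hyS

lemma card_le_two_mul_encard_drawingSegments [Finite V] (hD : G.IsStraightLineDrawing p)
    {D : Finset (V × V)} (hport : ∀ d ∈ D, IsPort G p d) :
    (D.card : ℕ∞) ≤ 2 * (G.drawingSegments p).encard := by
  classical
  choose! σ hσ hdσ using fun d (hd : d ∈ D) ↦ exists_mem_drawingSegments hD.1 (hport d hd).1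
  have hfin : (G.drawingSegments p).Finite := toFinite _
  have hle : D.card ≤ 2 * hfin.toFinset.card := by
    refine Finset.card_le_mul_card_image_of_maps_to (f := σ)
      (fun d hd ↦ hfin.mem_toFinset.2 (hσ d hd)) 2 fun S hS ↦ ?_
    refine card_isPort_le_two hD (hfin.mem_toFinset.1 hS).prop fun d hd ↦ ?_
    obtain ⟨hdD, rfl⟩ := Finset.mem_filter.1 hd
    exact ⟨hport d hdD, hdσ d hdD⟩
  rw [hfin.encard_eq_coe_toFinset_card]
  exact_mod_cast hle

end Port

lemma exists_isPort_finset [Fintype V] (hD : G.IsStraightLineDrawing p) (htree : G.IsKTree 3)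
    (hcard : 6 ≤ Fintype.card V) :
    ∃ D : Finset (V × V), 2 * (Fintype.card V + 4) ≤ D.card + 1 ∧ ∀ d ∈ D, IsPort G p d := by
  classical
  have hstacked : IsStacked 3 G Finset.univ := isStacked_univ htree
  obtain ⟨T, F, h⟩ := exists_isTriangulation hD hstacked
  have : Nonempty V := Fintype.card_pos_iff.1 (by omega)
  choose! δ hδ hδF using h.exists_enters
  have hext : ∀ v ∈ T, p v ∈ (face p T).extremePoints ℝ := fun v ↦
    mem_extremePoints_face hD h.isNClique_outer
  have hmem (v : V) : p v ∈ face p T := h.mem_outer v (Finset.mem_univ v)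
  have hinj : InjOn δ F := fun f hf g hg heq ↦ by
    by_contra hfg
    exact (hδF f hf).not_disjoint (heq ▸ hδF g hg) (h.pairwiseDisjoint hf hg hfg)
  have hdisj : Disjoint (F.image δ) (G.interedges Finset.univ T) := by
    refine Finset.disjoint_left.2 fun d hd hdT ↦ ?_
    obtain ⟨f, hf, rfl⟩ := Finset.mem_image.1 hd
    exact (hδF f hf).notMem_extremePoints hD.1 (hδ f hf) (hmem _) (h.face_subset_outer hf)
      (hext _ (G.mem_interedges_iff.1 hdT).2.1)
  have hfaces := h.card_add_five
  have hdegree := twelve_le_card_interedges hstacked h.isNClique_outer h.outer_subset hcard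
  rw [Finset.card_univ] at hfaces
  refine ⟨F.image δ ∪ G.interedges Finset.univ T, ?_, Finset.forall_mem_union.2 ⟨?_, fun d hd ↦ ?_⟩⟩
  · rw [Finset.card_union_of_disjoint hdisj, Finset.card_image_of_injOn hinj]
    omega
  · exact Finset.forall_mem_image.2 fun f hf ↦ (hδF f hf).isPort hD (h.isNClique f hf)
      (fun v ↦ h.notMem_interior f hf v (Finset.mem_univ v)) (hδ f hf)
  · obtain ⟨-, hdT, hd⟩ := G.mem_interedges_iff.1 hd
    exact isPort_of_mem_extremePoints hD.1 hmem hd (hext _ hdT)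

lemma card_add_four_le_encard_drawingSegments [Fintype V] (hD : G.IsStraightLineDrawing p)
    (htree : G.IsKTree 3) (hcard : 6 ≤ Fintype.card V) :
    ((Fintype.card V + 4 : ℕ) : ℕ∞) ≤ (G.drawingSegments p).encard := by
  obtain ⟨D, hD_card, hport⟩ := exists_isPort_finset hD htree hcard
  have hle := card_le_two_mul_encard_drawingSegments hD hport
  have hfin : (G.drawingSegments p).Finite := toFinite _
  rw [hfin.encard_eq_coe_toFinset_card] at hle ⊢
  norm_cast at hle ⊢
  omega

end StraightLineDrawing

theorem mainTheorem5 {V : Type*} [Fintype V] (G : SimpleGraph V)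
    (hplanar : G.IsPlanar) (htree : G.IsKTree 3) (hn : 6 ≤ Fintype.card V) :
    ((Fintype.card V + 4 : ℕ) : ℕ∞) ≤ G.segmentNumber :=
  le_iInf₂ fun _ hD ↦
    StraightLineDrawing.card_add_four_le_encard_drawingSegments hD htree hn
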